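/- \textbf{Definitions.} A \emph{tree-form decision problem} is a finite rooted tree in which two kinds of nodes alternate: decision points $j\in\mathcal J$ and observation points (sequences) $\sigma\in\Sigma$. The root $\varnothing$ is an observation point. Each decision point $j$ has a parent observation point $p_j$ and a nonempty set $A_j$ of actions, and the observation points other than $\varnothing$ are the children $ja$ ($j\in\mathcal J$, $a\in A_j$) of the decision points. For $\sigma\in\Sigma$ let $C_\sigma=\{j\in\mathcal J: p_j=\sigma\}$. Selecting one action at every decision point gives the \emph{sequence-form pure strategy} $x\in\{0,1\}^{\Sigma}$ with $x(\sigma)=1$ if and only if all actions on the path from $\varnothing$ to $\sigma$ are selected. The set of these vectors is the \emph{sequence-form strategy set}, and $\operatorname{co}$ denotes its convex hull. Let $\mathcal X,\mathcal Y$ be the sequence-form strategy sets of two tree-form decision problems with nodes $\Sigma_{\mathcal X}\cup\mathcal J_{\mathcal X}$ and $\Sigma_{\mathcal Y}\cup\mathcal J_{\mathcal Y}$. Consider the following decision problem of a deviator on a directed acyclic graph, whose nodes are pairs $(s,\tilde s)$ with $s\in\Sigma_{\mathcal X}\cup\mathcal J_{\mathcal X}$ and $\tilde s\in\Sigma_{\mathcal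 Y}\cup\mathcal J_{\mathcal Y}$ and whose root is $(\varnothing,\varnothing)$: \begin{itemize} \item At $(\sigma,\tilde\sigma)\in\Sigma_{\mathcal X}\times\Sigma_{\mathcal Y}$ the deviator observes some $j\in C_\sigma$ and moves to $(j,\tilde\sigma)$. \item At $(j,\tilde\sigma)\in\mathcal J_{\mathcal X}\times\Sigma_{\mathcal Y}$ the deviator chooses either to play an action $a\in A_j$, moving to $(ja,\tilde\sigma)$, or to query a decision point $\tilde\jmath\in C_{\tilde\sigma}$, moving to $(j,\tilde\jmath)$. \item At $(j,\tilde\jmath)\in\mathcal J_{\mathcal X}\times\mathcal J_{\mathcal Y}$ the deviator observes an action $a\in A_{\tilde\jmath}$ recommended by a mediator and moves to $(j,\tilde\jmath a)$. A mediator holding $y\in\mathcal Y$ recommends the action $a$ with $y(\tilde\jmath a)=1$. \end{itemize} A \emph{pure strategy} of the deviator fixes one choice at every $(j,\tilde\sigma)\in\mathcal J_{\mathcal X}\times\Sigma_{\mathcal Y}$. A \emph{(mixed) strategy} is a probability distribution over pure strategies. A strategy \emph{induces} the function $\phi$ on $\mathcal Y$ for which $\phi(y)(\sigma)$, with $y\in\mathcal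 Y$ and $\sigma\in\Sigma_{\mathcal X}$, is the probability that the deviator plays all the actions on the path to $\sigma$ when the mediator holds $y$. This means that some node $(\sigma,\tilde\sigma)$ is reached from $(\varnothing,\varnothing)$ by a path on which the deviator follows its strategy and the mediator replies according to $y$. \textbf{Theorem.} Let $\mathcal X,\mathcal Y$ be sequence-form strategy sets. The linear maps $\mathcal Y\to\operatorname{co}\mathcal X$, that is, the functions $\phi:\mathcal Y\to\operatorname{co}\mathcal X$ that are restrictions of linear maps $\mathbb R^{\Sigma_{\mathcal Y}}\to\mathbb R^{\Sigma_{\mathcal X}}$, are precisely the functions induced by (mixed) strategies of the deviator in this decision problem. In particular, every induced function takes values in $\operatorname{co}\mathcal X$. -/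

import Mathlib

universe u v

/-- A finite tree-form decision problem: a finite rooted tree in which observation points
(sequences) and decision points alternate and whose root is an observation point.

An observation point other than the root is the pair `ja` of a decision point `j` and an action
`a` legal at `j`, and `j` is its parent; so the set of sequences is `Option (Σ j, Action j)`, where
`none` is the root `∅`. The remaining data of the tree is the parent `p_j` of each decision point,
and well-foundedness says that the parent links have no cycle, so that every node lies below `∅`. -/
structure TreeFormDecisionProblem where
  /-- decision points -/
  Dec : Type u
  /-- the legal actions at a decision point -/
  Action : Dec → Type u
  /-- the observation point that immediately precedes a decision point -/
  parent : Dec → Option (Σ j : Dec, Action j)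
  finite_dec : Finite Dec
  finite_action : ∀ j, Finite (Action j)
  nonempty_action : ∀ j, Nonempty (Action j)
  wf : WellFounded fun i j : Dec => ∃ a : Action i, parent j = some ⟨i, a⟩

namespace TreeFormDecisionProblem

attribute [instance] finite_dec finite_action nonempty_action

/-- The observation points `Σ` (sequences) of a tree-form decision problem. -/
abbrev Seq (X : TreeFormDecisionProblem.{u}) : Type u := Option (Σ j : X.Dec, X.Action j)

/-- The root observation point `∅`. -/
abbrev root (X : TreeFormDecisionProblem.{u}) : X.Seq := none

/-- The observation point `ja`. -/
abbrev seq (X : TreeFormDecisionProblem.{u}) (j : X.Dec) (a : X.Action j) : X.Seq := some ⟨j, a⟩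

/-- All nodes of the tree, `Σ ∪ J`. -/
inductive Node (X : TreeFormDecisionProblem.{u}) : Type u
  /-- an observation point -/
  | obs (σ : X.Seq) : Node X
  /-- a decision point -/
  | dec (j : X.Dec) : Node X

/-- `X.Plays f σ`: the player who selects the action `f j` at each decision point `j` selects every
action on the path from the root to `σ`. -/
inductive Plays (X : TreeFormDecisionProblem.{u}) (f : ∀ j, X.Action j) : X.Seq → Prop
  | root : Plays X f X.root
  | step (j : X.Dec) : Plays X f (X.parent j) → Plays X f (X.seq j (f j))

open Classical in
/-- The sequence form of a selection of one action at each decision point. -/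
noncomputable def seqForm (X : TreeFormDecisionProblem.{u}) (f : ∀ j, X.Action j) : X.Seq → ℝ :=
  fun σ => if X.Plays f σ then 1 else 0

/-- The set `𝒳` of sequence-form pure strategies. -/
def pureStrategies (X : TreeFormDecisionProblem.{u}) : Set (X.Seq → ℝ) :=
  Set.range X.seqForm

/-- The set `co 𝒳` of sequence-form mixed strategies. -/
def mixedStrategies (X : TreeFormDecisionProblem.{u}) : Set (X.Seq → ℝ) :=
  convexHull ℝ X.pureStrategies

/-- The linear maps `𝒴 → co 𝒳`: functions on `𝒴` with values in `co 𝒳` that are restrictions of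
linear maps between the ambient spaces. -/
def linearMaps (Y : TreeFormDecisionProblem.{v}) (X : TreeFormDecisionProblem.{u}) :
    Set (Y.pureStrategies → X.Seq → ℝ) :=
  {φ | (∀ y, φ y ∈ X.mixedStrategies) ∧
    ∃ L : (Y.Seq → ℝ) →ₗ[ℝ] (X.Seq → ℝ), ∀ y : Y.pureStrategies, φ y = L y}

end TreeFormDecisionProblem

/-! ### The untimed communication (UTC) decision problem

The nodes are pairs `(s, t)` of a node `s` of `X` (the state of the real decision problem) and a
node `t` of `Y` (the state of the interaction with the mediator); the decision points are the pairs
`(j, τ)` with `j` a decision point of `X` and `τ` an observation point of `Y`. -/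

namespace UTC

open TreeFormDecisionProblem

/-- What the deviator can do at the decision point `(j, τ)`: play an action legal at `j` in the
real decision problem, or query the mediator at a decision point `q` of `Y` that follows `τ`. -/
abbrev Choice (X : TreeFormDecisionProblem.{u}) (Y : TreeFormDecisionProblem.{v})
    (j : X.Dec) (τ : Y.Seq) : Type (max u v) :=
  X.Action j ⊕ {q : Y.Dec // Y.parent q = τ}

/-- A pure strategy of the deviator: one choice at each decision point of the UTC DAG. -/
abbrev PureStrategy (X : TreeFormDecisionProblem.{u}) (Y : TreeFormDecisionProblem.{v}) :
    Type (max u v) :=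
  ∀ (j : X.Dec) (τ : Y.Seq), Choice X Y j τ

noncomputable instance (X : TreeFormDecisionProblem.{u}) (Y : TreeFormDecisionProblem.{v}) :
    Fintype (PureStrategy X Y) :=
  Fintype.ofFinite _

/-- `Reaches π y s t`: there is a path in the UTC DAG from `(∅, ∅)` to `(s, t)` on which the
deviator plays by the pure strategy `π` and the mediator replies to each query `q` by the
action that `y` recommends at `q`, that is, the `b` with `y (q b) = 1`. -/
inductive Reaches {X : TreeFormDecisionProblem.{u}} {Y : TreeFormDecisionProblem.{v}}
    (π : PureStrategy X Y) (y : Y.Seq → ℝ) : X.Node → Y.Node → Prop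
  /-- the root -/
  | root : Reaches π y (.obs X.root) (.obs Y.root)
  /-- `(σ, τ)` is an observation point: the next real decision point `j` is observed -/
  | observe (j : X.Dec) (τ : Y.Seq) :
      Reaches π y (.obs (X.parent j)) (.obs τ) → Reaches π y (.dec j) (.obs τ)
  /-- at `(j, τ)` the deviator plays an action in the real decision problem -/
  | act (j : X.Dec) (τ : Y.Seq) (a : X.Action j) :
      Reaches π y (.dec j) (.obs τ) → π j τ = .inl a → Reaches π y (.obs (X.seq j a)) (.obs τ)
  /-- at `(j, τ)` the deviator queries a decision point of the mediator that follows `τ` -/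
  | query (j : X.Dec) (τ : Y.Seq) (q : {q : Y.Dec // Y.parent q = τ}) :
      Reaches π y (.dec j) (.obs τ) → π j τ = .inr q → Reaches π y (.dec j) (.dec q)
  /-- `(j, q)` is an observation point: the action recommended at `q` is observed -/
  | reply (j : X.Dec) (q : Y.Dec) (b : Y.Action q) :
      Reaches π y (.dec j) (.dec q) → y (Y.seq q b) = 1 →
      Reaches π y (.dec j) (.obs (Y.seq q b))

/-- The deviator, using `π` against a mediator who recommends according to `y`, plays all the
actions on the path to `σ` in the real decision problem. -/
def PlaysTo {X : TreeFormDecisionProblem.{u}} {Y : TreeFormDecisionProblem.{v}}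
    (π : PureStrategy X Y) (y : Y.Seq → ℝ) (σ : X.Seq) : Prop :=
  ∃ τ : Y.Seq, Reaches π y (.obs σ) (.obs τ)

open Classical in
/-- The function induced by a mixed strategy `w`, a probability distribution on the pure
strategies: it sends `y ∈ 𝒴` to the vector whose `σ`-entry is the probability that the deviator
plays all the actions on the path to `σ` when the mediator recommends according to `y`. -/
noncomputable def inducedMap {X : TreeFormDecisionProblem.{u}} {Y : TreeFormDecisionProblem.{v}}
    (w : stdSimplex ℝ (PureStrategy X Y)) : Y.pureStrategies → X.Seq → ℝ :=
  fun y σ => ∑ π : PureStrategy X Y, if PlaysTo π y σ then w.1 π else 0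

end UTC

/-! Against a fixed mediator strategy, a pure strategy of the deviator plays like a pure strategy of
`X`, so induced values lie in `co 𝒳`. It reaches `(σ, τ)` iff that node is reachable under some
replies and the mediator plays to `τ`. Hence `φ(y)(σ)` is the sum over `τ` of the probability of
reachability times `y(τ)`, which is linear in `y`.

Conversely, each coordinate of a linear `φ` is a nonnegative linear function on `𝒴`. Its
coefficients are not unique; `canon` picks nonnegative ones by moving mass as far towards the root
as possible, and it depends only on the function (`canon_congr`). The functions at the sequences
`ja` add up to the one at `p_j`, but their canonical coefficients need not: minima are only
superadditive (`sum_decValue_le`), and the slack at `q` is mass to be moved from the parent of `q`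
to every `qb` (`canon_sum_add`). Read as query mass, the slack makes the canonical coefficients a
flow on the DAG.

Normalising the flow gives a behavioral strategy, realized by a product distribution, that visits no
node more often than the flow does (`IsFlow.exists_reachProb_le`). So the induced map is at most `φ`
in every coordinate, and equality is automatic because points of `co 𝒳` are pairwise incomparable
(`eq_of_mixedStrategies_le`). -/

namespace TreeFormDecisionProblem

/-! ### Tree induction and the sequence-form constraints -/

variable (X : TreeFormDecisionProblem.{u})

noncomputable instance fintypeDec : Fintype X.Dec := Fintype.ofFinite _

noncomputable instance fintypeAction (j : X.Dec) : Fintype (X.Action j) := Fintype.ofFinite _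

noncomputable instance fintypeChildren (σ : X.Seq) : Fintype {j : X.Dec // X.parent j = σ} :=
  Fintype.ofFinite _

/-- Induction on sequences from the root towards the leaves. -/
theorem seq_induction {P : X.Seq → Prop} (root : P X.root)
    (step : ∀ j a, P (X.parent j) → P (X.seq j a)) (σ : X.Seq) : P σ := by
  have key : ∀ j, P (X.parent j) := by
    intro j
    induction j using X.wf.induction with
    | _ j ih =>
      rcases h : X.parent j with _ | ⟨i, a⟩
      · exact root
      · exact step i a (ih i ⟨a, h⟩)
  rcases σ with _ | ⟨j, a⟩
  · exact root
  · exact step j a (key j)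

/-- There is a function measuring the depth of each sequence. -/
theorem exists_level : ∃ l : X.Seq → ℕ, ∀ j a, l (X.seq j a) = l (X.parent j) + 1 := by
  let F : ∀ j : X.Dec, (∀ i : X.Dec, (∃ a : X.Action i, X.parent j = some ⟨i, a⟩) → ℕ) → ℕ :=
    fun j r => match h : X.parent j with
      | none => 0
      | some ⟨i, a⟩ => r i ⟨a, h⟩ + 1
  refine ⟨fun σ => σ.elim 0 fun s => X.wf.fix F s.1 + 1, fun j a => ?_⟩
  have h1 : X.wf.fix F j = (X.parent j).elim 0 fun s => X.wf.fix F s.1 + 1 := by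
    rw [WellFounded.fix_eq]
    simp only [F]
    split
    · next h => rw [h]; rfl
    · next h => rw [h]; rfl
  simp [h1]

/-- The depth of a sequence. -/
noncomputable def level : X.Seq → ℕ := X.exists_level.choose

theorem level_seq (j : X.Dec) (a : X.Action j) :
    X.level (X.seq j a) = X.level (X.parent j) + 1 :=
  X.exists_level.choose_spec j a

/-- Finiteness bounds the depth, so recursion may also run away from the root, as `lowerValue` and
`finalMove` do. -/
theorem wf_level : WellFounded fun σ' σ : X.Seq => X.level σ < X.level σ' := by
  have : IsTrans X.Seq fun σ' σ => X.level σ < X.level σ' := ⟨fun _ _ _ h h' => h'.trans h⟩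
  have : Std.Irrefl fun σ' σ : X.Seq => X.level σ < X.level σ' := ⟨fun _ h => lt_irrefl _ h⟩
  exact Finite.wellFounded_of_trans_of_irrefl _

theorem level_lt {j : X.Dec} {σ : X.Seq} (h : X.parent j = σ) (a : X.Action j) :
    X.level σ < X.level (X.seq j a) := by
  rw [level_seq, h]; exact Nat.lt_succ_self _

/-- Induction on sequences from the leaves towards the root. -/
theorem seq_induction_up {P : X.Seq → Prop}
    (step : ∀ σ, (∀ j a, X.parent j = σ → P (X.seq j a)) → P σ) (σ : X.Seq) : P σ := by
  induction σ using X.wf_level.induction with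
  | _ σ ih => exact step σ fun j a h => ih _ (X.level_lt h a)

theorem sum_seq (F : X.Seq → ℝ) :
    ∑ σ, F σ = F X.root + ∑ j, ∑ a, F (X.seq j a) := by
  rw [Fintype.sum_option, Fintype.sum_sigma]

theorem sum_children (F : X.Seq → X.Dec → ℝ) :
    ∑ σ, ∑ j : {j : X.Dec // X.parent j = σ}, F σ j = ∑ j, F (X.parent j) j := by
  rw [← Fintype.sum_sigma' (f := fun σ (j : {j : X.Dec // X.parent j = σ}) => F σ j)]
  refine Fintype.sum_equiv (Equiv.sigmaFiberEquiv X.parent) _ _ ?_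
  rintro ⟨σ, j, rfl⟩
  rfl

variable {X}

theorem plays_seq {f : ∀ j, X.Action j} {j : X.Dec} {a : X.Action j} :
    X.Plays f (X.seq j a) ↔ a = f j ∧ X.Plays f (X.parent j) := by
  constructor
  · rintro ⟨⟩
    exact ⟨rfl, by assumption⟩
  · rintro ⟨rfl, h⟩
    exact Plays.step j h

theorem seqForm_eq_one {f : ∀ j, X.Action j} {σ : X.Seq} : X.seqForm f σ = 1 ↔ X.Plays f σ := by
  unfold seqForm; split <;> simp [*]

theorem seqForm_eq_zero {f : ∀ j, X.Action j} {σ : X.Seq} (h : ¬ X.Plays f σ) :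
    X.seqForm f σ = 0 :=
  if_neg h

theorem seqForm_root (f : ∀ j, X.Action j) : X.seqForm f X.root = 1 :=
  seqForm_eq_one.2 Plays.root

theorem seqForm_nonneg (f : ∀ j, X.Action j) (σ : X.Seq) : 0 ≤ X.seqForm f σ := by
  unfold seqForm; split <;> norm_num

theorem seqForm_seq_of_ne {f : ∀ j, X.Action j} {j : X.Dec} {a : X.Action j} (h : a ≠ f j) :
    X.seqForm f (X.seq j a) = 0 := by
  refine seqForm_eq_zero ?_
  rw [plays_seq]
  tauto

theorem sum_mul_seqForm (f : ∀ j, X.Action j) (j : X.Dec) (r : X.Action j → ℝ) :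
    ∑ a, r a * X.seqForm f (X.seq j a) = r (f j) * X.seqForm f (X.parent j) := by
  rw [Fintype.sum_eq_single (f j)]
  · congr 1
    by_cases h : X.Plays f (X.parent j) <;> simp [seqForm, plays_seq, h]
  · intro a ha
    rw [seqForm_seq_of_ne ha, mul_zero]

theorem sum_seqForm (f : ∀ j, X.Action j) (j : X.Dec) :
    ∑ a, X.seqForm f (X.seq j a) = X.seqForm f (X.parent j) := by
  simpa using sum_mul_seqForm f j fun _ => 1

/-- Mixed strategies satisfy the sequence-form constraints. -/
theorem mixedStrategies_constraints {x : X.Seq → ℝ} (hx : x ∈ X.mixedStrategies) :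
    (∀ σ, 0 ≤ x σ) ∧ x X.root = 1 ∧ ∀ j, ∑ a, x (X.seq j a) = x (X.parent j) := by
  let S : Set (X.Seq → ℝ) :=
    {x | (∀ σ, 0 ≤ x σ) ∧ x X.root = 1 ∧ ∀ j, ∑ a, x (X.seq j a) = x (X.parent j)}
  have hS : Convex ℝ S := by
    rintro x ⟨hx0, hx1, hx2⟩ y ⟨hy0, hy1, hy2⟩ s t hs ht hst
    refine ⟨fun σ => ?_, ?_, fun j => ?_⟩
    · have := hx0 σ
      have := hy0 σ
      simp only [Pi.add_apply, Pi.smul_apply, smul_eq_mul]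
      positivity
    · simp only [Pi.add_apply, Pi.smul_apply, smul_eq_mul, hx1, hy1, mul_one, hst]
    · simp only [Pi.add_apply, Pi.smul_apply, smul_eq_mul, Finset.sum_add_distrib,
        ← Finset.mul_sum, hx2, hy2]
  refine convexHull_min ?_ hS hx
  rintro _ ⟨f, rfl⟩
  exact ⟨seqForm_nonneg f, seqForm_root f, sum_seqForm f⟩

/-- Mixed strategies are pairwise incomparable. -/
theorem eq_of_mixedStrategies_le {x x' : X.Seq → ℝ} (hx : x ∈ X.mixedStrategies)
    (hx' : x' ∈ X.mixedStrategies) (h : ∀ σ, x σ ≤ x' σ) : x = x' := by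
  obtain ⟨-, h1, h2⟩ := mixedStrategies_constraints hx
  obtain ⟨-, h1', h2'⟩ := mixedStrategies_constraints hx'
  funext σ
  induction σ using X.seq_induction with
  | root => rw [h1, h1']
  | step j a ih =>
    -- The two families of children have equal sums, so the termwise inequality is an equality.
    rw [← h2, ← h2'] at ih
    exact (Finset.sum_eq_sum_iff_of_le fun a _ => h (X.seq j a)).1 ih a (Finset.mem_univ a)

/-! ### The canonical nonnegative representation of a linear function -/

section LowerValue

variable (X)

/-- The least value, over the pure strategies in the subtree below `σ`, of the linear function with
coefficients `c`. -/
noncomputable def lowerValue (c : X.Seq → ℝ) (σ : X.Seq) : ℝ :=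
  c σ + ∑ j : {j : X.Dec // X.parent j = σ}, ⨅ a : X.Action j, lowerValue c (X.seq j a)
termination_by X.wf_level.wrap σ
decreasing_by exact X.level_lt j.2 a

/-- The least value of the linear function with coefficients `c` below a decision point. -/
noncomputable def decValue (c : X.Seq → ℝ) (j : X.Dec) : ℝ :=
  ⨅ a : X.Action j, X.lowerValue c (X.seq j a)

theorem lowerValue_eq (c : X.Seq → ℝ) (σ : X.Seq) :
    X.lowerValue c σ = c σ + ∑ j : {j : X.Dec // X.parent j = σ}, X.decValue c j := by
  rw [lowerValue]; rfl

theorem decValue_le (c : X.Seq → ℝ) (j : X.Dec) (a : X.Action j) :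
    X.decValue c j ≤ X.lowerValue c (X.seq j a) :=
  ciInf_le (Set.finite_range _).bddBelow a

theorem exists_decValue_eq (c : X.Seq → ℝ) (j : X.Dec) :
    ∃ a, X.lowerValue c (X.seq j a) = X.decValue c j :=
  exists_eq_ciInf_of_finite

theorem lowerValue_zero (σ : X.Seq) : X.lowerValue 0 σ = 0 := by
  induction σ using X.seq_induction_up with
  | step σ ih =>
    rw [lowerValue_eq, Finset.sum_eq_zero, Pi.zero_apply, add_zero]
    intro j _
    obtain ⟨a, ha⟩ := X.exists_decValue_eq 0 j
    rw [← ha, ih j a j.2]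

theorem decValue_zero (j : X.Dec) : X.decValue 0 j = 0 := by
  obtain ⟨a, ha⟩ := X.exists_decValue_eq 0 j
  rw [← ha, lowerValue_zero]

/-- An action minimizing the sum at a decision point is only one candidate in each of the two
separate minima. -/
theorem lowerValue_add_le (c d : X.Seq → ℝ) (σ : X.Seq) :
    X.lowerValue c σ + X.lowerValue d σ ≤ X.lowerValue (c + d) σ := by
  induction σ using X.seq_induction_up with
  | step σ ih =>
    have h : ∑ j : {j : X.Dec // X.parent j = σ}, (X.decValue c j + X.decValue d j) ≤
        ∑ j : {j : X.Dec // X.parent j = σ}, X.decValue (c + d) j := by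
      refine Finset.sum_le_sum fun j _ => ?_
      obtain ⟨a, ha⟩ := X.exists_decValue_eq (c + d) j
      rw [← ha]
      exact (add_le_add (X.decValue_le c j a) (X.decValue_le d j a)).trans (ih j a j.2)
    rw [Finset.sum_add_distrib] at h
    simp only [lowerValue_eq, Pi.add_apply]
    linarith

theorem decValue_add_le (c d : X.Seq → ℝ) (j : X.Dec) :
    X.decValue c j + X.decValue d j ≤ X.decValue (c + d) j := by
  obtain ⟨a, ha⟩ := X.exists_decValue_eq (c + d) j
  rw [← ha]
  exact (add_le_add (X.decValue_le c j a) (X.decValue_le d j a)).trans (X.lowerValue_add_le c d _)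

theorem sum_decValue_le {ι : Type*} (s : Finset ι) (c : ι → X.Seq → ℝ) (j : X.Dec) :
    ∑ i ∈ s, X.decValue (c i) j ≤ X.decValue (∑ i ∈ s, c i) j := by
  classical
  induction s using Finset.induction with
  | empty => simp [decValue_zero]
  | insert i s hi ih =>
    rw [Finset.sum_insert hi, Finset.sum_insert hi]
    linarith [X.decValue_add_le (c i) (∑ i ∈ s, c i) j]

/-- The canonical coefficients of a linear function on the pure strategies: as much mass as
possible is moved towards the root. -/
noncomputable def canon (c : X.Seq → ℝ) : X.Seq → ℝ
  | none => X.lowerValue c none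
  | some s => X.lowerValue c (some s) - X.decValue c s.1

theorem canon_seq (c : X.Seq → ℝ) (j : X.Dec) (a : X.Action j) :
    X.canon c (X.seq j a) = X.lowerValue c (X.seq j a) - X.decValue c j := rfl

theorem canon_seq_nonneg (c : X.Seq → ℝ) (j : X.Dec) (a : X.Action j) :
    0 ≤ X.canon c (X.seq j a) :=
  sub_nonneg.2 (X.decValue_le c j a)

/-- Moving `decValue c j` from all the children `ja` to `p_j` is harmless, since the children of `j`
sum to the parent in every pure strategy. -/
theorem sum_canon_mul_seqForm (c : X.Seq → ℝ) (f : ∀ j, X.Action j) :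
    ∑ σ, X.canon c σ * X.seqForm f σ = ∑ σ, c σ * X.seqForm f σ := by
  have h1 : ∑ σ, X.lowerValue c σ * X.seqForm f σ =
      ∑ σ, c σ * X.seqForm f σ + ∑ j, X.decValue c j * X.seqForm f (X.parent j) := by
    rw [← X.sum_children fun σ j => X.decValue c j * X.seqForm f σ, ← Finset.sum_add_distrib]
    refine Finset.sum_congr rfl fun σ _ => ?_
    rw [lowerValue_eq, add_mul, Finset.sum_mul]
  rw [sum_seq] at h1 ⊢
  have h2 : ∀ j, ∑ a, X.canon c (X.seq j a) * X.seqForm f (X.seq j a) =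
      ∑ a, X.lowerValue c (X.seq j a) * X.seqForm f (X.seq j a) -
        X.decValue c j * X.seqForm f (X.parent j) := by
    intro j
    rw [← sum_seqForm f j, Finset.mul_sum, ← Finset.sum_sub_distrib]
    exact Finset.sum_congr rfl fun a _ => by rw [canon_seq, sub_mul]
  simp only [h2, Finset.sum_sub_distrib]
  have h3 : X.canon c X.root = X.lowerValue c X.root := rfl
  rw [h3]
  linarith

/-- The root value is attained by a pure strategy. -/
theorem exists_lowerValue_root (c : X.Seq → ℝ) :
    ∃ f, ∑ σ, c σ * X.seqForm f σ = X.lowerValue c X.root := by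
  -- With a minimizing action everywhere, only the root term of the canonical form survives.
  choose f hf using X.exists_decValue_eq c
  refine ⟨f, ?_⟩
  rw [← sum_canon_mul_seqForm, sum_seq, Finset.sum_eq_zero, seqForm_root, add_zero, mul_one]
  · rfl
  · intro j _
    rw [sum_mul_seqForm, canon_seq, hf, sub_self, zero_mul]

theorem canon_nonneg {c : X.Seq → ℝ} (hc : ∀ f, 0 ≤ ∑ σ, c σ * X.seqForm f σ) (σ : X.Seq) :
    0 ≤ X.canon c σ := by
  rcases σ with _ | ⟨j, a⟩
  · obtain ⟨f, hf⟩ := X.exists_lowerValue_root c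
    exact (hc f).trans_eq hf
  · exact X.canon_seq_nonneg c j a

theorem lowerValue_add_neg_le (c : X.Seq → ℝ) (σ : X.Seq) :
    X.lowerValue c σ + X.lowerValue (-c) σ ≤ 0 := by
  simpa [lowerValue_zero] using X.lowerValue_add_le c (-c) σ

theorem decValue_add_neg_le (c : X.Seq → ℝ) (j : X.Dec) :
    X.decValue c j + X.decValue (-c) j ≤ 0 := by
  simpa [decValue_zero] using X.decValue_add_le c (-c) j

theorem decValue_add_neg {c : X.Seq → ℝ} {j : X.Dec}
    (h : X.lowerValue c (X.parent j) + X.lowerValue (-c) (X.parent j) = 0) :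
    X.decValue c j + X.decValue (-c) j = 0 := by
  rw [lowerValue_eq, lowerValue_eq, Pi.neg_apply] at h
  have h' : ∑ i : {i : X.Dec // X.parent i = X.parent j},
      (X.decValue c i + X.decValue (-c) i) = 0 := by
    rw [Finset.sum_add_distrib]; linarith
  exact (Finset.sum_eq_zero_iff_of_nonpos fun (i : {i // X.parent i = X.parent j}) _ =>
    X.decValue_add_neg_le c i).1 h' ⟨j, rfl⟩ (Finset.mem_univ _)

/-- There is no slack at the root, and `decValue_add_neg` together with superadditivity carries this
down the tree. -/
theorem lowerValue_add_neg {c : X.Seq → ℝ} (hc : ∀ f, ∑ σ, c σ * X.seqForm f σ = 0)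
    (σ : X.Seq) : X.lowerValue c σ + X.lowerValue (-c) σ = 0 := by
  induction σ using X.seq_induction with
  | root =>
    obtain ⟨f, hf⟩ := X.exists_lowerValue_root c
    obtain ⟨g, hg⟩ := X.exists_lowerValue_root (-c)
    rw [← hf, ← hg, hc]
    simp [hc]
  | step j a ih =>
    have := X.decValue_add_neg ih
    have := X.decValue_le c j a
    have := X.decValue_le (-c) j a
    have := X.lowerValue_add_neg_le c (X.seq j a)
    linarith

theorem canon_eq_zero {c : X.Seq → ℝ} (hc : ∀ f, ∑ σ, c σ * X.seqForm f σ = 0) (σ : X.Seq) :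
    X.canon c σ = 0 := by
  rcases σ with _ | ⟨j, a⟩
  · obtain ⟨f, hf⟩ := X.exists_lowerValue_root c
    exact hf.symm.trans (hc f)
  · have := X.decValue_add_neg (X.lowerValue_add_neg hc (X.parent j))
    have := X.decValue_le c j a
    have := X.decValue_le (-c) j a
    have := X.lowerValue_add_neg_le c (X.seq j a)
    change X.lowerValue c (X.seq j a) - X.decValue c j = 0
    linarith

/-- The canonical coefficients depend only on the function on the pure strategies. -/
theorem canon_congr {c c' : X.Seq → ℝ}
    (h : ∀ f, ∑ σ, c σ * X.seqForm f σ = ∑ σ, c' σ * X.seqForm f σ) : X.canon c = X.canon c' := by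
  have hd : ∀ f, ∑ σ, (c' - c) σ * X.seqForm f σ = 0 := fun f => by
    simp [sub_mul, h]
  have hc : c + (c' - c) = c' := by abel
  have hc' : c' + -(c' - c) = c := by abel
  -- Superadditivity for `c + d = c'` and for `c' - d = c`, with `d = c' - c`, gives both
  -- inequalities because `d` has no slack.
  have hU : ∀ σ, X.lowerValue c' σ = X.lowerValue c σ + X.lowerValue (c' - c) σ := fun σ => by
    have h1 := X.lowerValue_add_le c (c' - c) σ
    have h2 := X.lowerValue_add_le c' (-(c' - c)) σ
    rw [hc] at h1
    rw [hc'] at h2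
    linarith [X.lowerValue_add_neg hd σ]
  have hV : ∀ j, X.decValue c' j = X.decValue c j + X.decValue (c' - c) j := fun j => by
    have h1 := X.decValue_add_le c (c' - c) j
    have h2 := X.decValue_add_le c' (-(c' - c)) j
    rw [hc] at h1
    rw [hc'] at h2
    linarith [X.decValue_add_neg (X.lowerValue_add_neg hd (X.parent j))]
  funext σ
  have h0 := X.canon_eq_zero hd σ
  rcases σ with _ | ⟨j, a⟩
  · change X.lowerValue _ _ = 0 at h0
    change X.lowerValue _ _ = X.lowerValue _ _
    rw [hU, h0, add_zero]
  · change X.lowerValue _ _ - X.decValue _ _ = 0 at h0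
    change X.lowerValue _ _ - X.decValue _ _ = X.lowerValue _ _ - X.decValue _ _
    rw [hU, hV]
    linarith

/-- Splitting a linear function into summands moves mass away from the root only: the mass moved
through the decision point `j` is `decValue (∑ c i) j - ∑ decValue (c i) j`, which is
nonnegative. -/
theorem canon_sum_add {ι : Type*} [Fintype ι] (c : ι → X.Seq → ℝ) (σ : X.Seq) :
    X.canon (∑ i, c i) σ + σ.elim 0 (fun s =>
        X.decValue (∑ i, c i) s.1 - ∑ i, X.decValue (c i) s.1) =
      ∑ i, X.canon (c i) σ + ∑ j : {j : X.Dec // X.parent j = σ},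
        (X.decValue (∑ i, c i) j - ∑ i, X.decValue (c i) j) := by
  have h : X.lowerValue (∑ i, c i) σ = ∑ i, X.lowerValue (c i) σ +
      ∑ j : {j : X.Dec // X.parent j = σ},
        (X.decValue (∑ i, c i) j - ∑ i, X.decValue (c i) j) := by
    simp only [lowerValue_eq, Finset.sum_apply, Finset.sum_add_distrib, Finset.sum_sub_distrib]
    rw [Finset.sum_comm (s := (Finset.univ : Finset ι))]
    ring
  rcases σ with _ | ⟨j, a⟩
  · simp only [canon, Option.elim, add_zero]
    exact h
  · simp only [canon, Option.elim, Finset.sum_sub_distrib] at h ⊢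
    rw [h]
    ring

end LowerValue

end TreeFormDecisionProblem

namespace UTC

open TreeFormDecisionProblem

variable {X : TreeFormDecisionProblem.{u}} {Y : TreeFormDecisionProblem.{v}}

/-! ### Induced functions are linear maps into `co 𝒳` -/

section Induced

/-- The action that the deviator eventually plays at `j` when starting to query the mediator at
`τ`, and the state of the mediator at that time. -/
noncomputable def finalMove (π : PureStrategy X Y) (g : ∀ q, Y.Action q) (j : X.Dec) (τ : Y.Seq) :
    X.Action j × Y.Seq :=
  match π j τ with
  | .inl a => (a, τ)
  | .inr q => finalMove π g j (Y.seq q (g q))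
termination_by Y.wf_level.wrap τ
decreasing_by exact Y.level_lt q.2 _

theorem finalMove_act {π : PureStrategy X Y} {g : ∀ q, Y.Action q} {j : X.Dec} {τ : Y.Seq}
    {a : X.Action j} (h : π j τ = .inl a) : finalMove π g j τ = (a, τ) := by
  rw [finalMove, h]

theorem finalMove_query {π : PureStrategy X Y} {g : ∀ q, Y.Action q} {j : X.Dec} {τ : Y.Seq}
    {q : {q : Y.Dec // Y.parent q = τ}} (h : π j τ = .inr q) :
    finalMove π g j τ = finalMove π g j (Y.seq q (g q)) := by
  rw [finalMove, h]

/-- The state of the mediator when the deviator reaches `σ`, if the deviator does so. -/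
noncomputable def mediatorState (π : PureStrategy X Y) (g : ∀ q, Y.Action q) : X.Seq → Y.Seq
  | none => none
  | some ⟨j, _⟩ => (finalMove π g j (mediatorState π g (X.parent j))).2
termination_by σ => X.level σ
decreasing_by exact X.level_lt rfl _

/-- The action that the deviator plays at each decision point. -/
noncomputable def response (π : PureStrategy X Y) (g : ∀ q, Y.Action q) (j : X.Dec) : X.Action j :=
  (finalMove π g j (mediatorState π g (X.parent j))).1

theorem mediatorState_root (π : PureStrategy X Y) (g : ∀ q, Y.Action q) :
    mediatorState π g X.root = Y.root := by
  rw [mediatorState]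

theorem mediatorState_seq (π : PureStrategy X Y) (g : ∀ q, Y.Action q) (j : X.Dec)
    (a : X.Action j) :
    mediatorState π g (X.seq j a) = (finalMove π g j (mediatorState π g (X.parent j))).2 := by
  rw [mediatorState]

/-- What holds at a node reached by the deviator. -/
def ReachInv (π : PureStrategy X Y) (g : ∀ q, Y.Action q) : X.Node → Y.Node → Prop
  | .obs σ, .obs τ => X.Plays (response π g) σ ∧ mediatorState π g σ = τ ∧ Y.Plays g τ
  -- Queries at `j` only unfold the recursion of `finalMove`, so its result is invariant while they
  -- last.
  | .dec j, .obs τ => X.Plays (response π g) (X.parent j) ∧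
      finalMove π g j τ = finalMove π g j (mediatorState π g (X.parent j)) ∧ Y.Plays g τ
  | .dec j, .dec q => X.Plays (response π g) (X.parent j) ∧
      finalMove π g j (Y.seq q (g q)) = finalMove π g j (mediatorState π g (X.parent j)) ∧
      Y.Plays g (Y.parent q)
  | .obs _, .dec _ => True

theorem Reaches.inv {π : PureStrategy X Y} {g : ∀ q, Y.Action q} {s : X.Node} {t : Y.Node}
    (h : Reaches π (Y.seqForm g) s t) : ReachInv π g s t := by
  induction h with
  | root => exact ⟨.root, mediatorState_root π g, .root⟩
  | observe j τ _ ih => exact ⟨ih.1, by rw [ih.2.1], ih.2.2⟩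
  | act j τ a _ ha ih =>
    obtain ⟨h1, h2, h3⟩ := ih
    rw [finalMove_act ha] at h2
    refine ⟨plays_seq.2 ⟨?_, h1⟩, ?_, h3⟩
    · rw [response, ← h2]
    · rw [mediatorState_seq, ← h2]
  | query j τ q _ hq ih =>
    obtain ⟨h1, h2, h3⟩ := ih
    refine ⟨h1, by rw [← finalMove_query hq, h2], ?_⟩
    rw [q.2]
    exact h3
  | reply j q b _ hb ih =>
    obtain ⟨h1, h2, h3⟩ := ih
    rw [seqForm_eq_one] at hb
    obtain ⟨rfl, -⟩ := plays_seq.1 hb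
    exact ⟨h1, h2, hb⟩

theorem reaches_finalMove {π : PureStrategy X Y} {g : ∀ q, Y.Action q} {j : X.Dec} (τ : Y.Seq)
    (h : Reaches π (Y.seqForm g) (.dec j) (.obs τ)) :
    Reaches π (Y.seqForm g) (.obs (X.seq j (finalMove π g j τ).1)) (.obs (finalMove π g j τ).2) := by
  induction τ using Y.seq_induction_up with
  | step τ ih =>
    rcases hc : π j τ with a | q
    · rw [finalMove_act hc]
      exact .act j τ a h hc
    · rw [finalMove_query hc]
      have hy : Y.seqForm g (Y.seq q (g q)) = 1 := by
        rw [seqForm_eq_one, plays_seq, q.2]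
        exact ⟨rfl, h.inv.2.2⟩
      exact ih q _ q.2 (Reaches.reply (Y := Y) j q.1 (g q.1) (.query j τ q h hc) hy)

theorem reaches_of_plays {π : PureStrategy X Y} {g : ∀ q, Y.Action q} {σ : X.Seq}
    (h : X.Plays (response π g) σ) :
    Reaches π (Y.seqForm g) (.obs σ) (.obs (mediatorState π g σ)) := by
  induction h with
  | root => rw [mediatorState_root]; exact .root
  | step j _ ih =>
    rw [mediatorState_seq]
    exact reaches_finalMove _ (.observe j _ ih)

theorem playsTo_iff {π : PureStrategy X Y} {g : ∀ q, Y.Action q} {σ : X.Seq} :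
    PlaysTo π (Y.seqForm g) σ ↔ X.Plays (response π g) σ :=
  ⟨fun ⟨_, h⟩ => h.inv.1, fun h => ⟨_, reaches_of_plays h⟩⟩

/-! ### Reachability independent of the mediator, and linearity -/

/-- The node can be reached under some replies of the mediator. -/
def Reachable (π : PureStrategy X Y) : X.Node → Y.Node → Prop := Reaches π 1

theorem Reaches.reachable {π : PureStrategy X Y} {y : Y.Seq → ℝ} {s : X.Node} {t : Y.Node}
    (h : Reaches π y s t) : Reachable π s t := by
  induction h with
  | root => exact Reaches.root
  | observe j τ _ ih => exact Reaches.observe j τ ih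
  | act j τ a _ ha ih => exact Reaches.act j τ a ih ha
  | query j τ q _ hq ih => exact Reaches.query j τ q ih hq
  | reply j q b _ _ ih => exact Reaches.reply j q b ih rfl

/-- The last sequence on the path to a node: the node itself, or the parent of a decision point. -/
def lastSeq (Y : TreeFormDecisionProblem.{v}) : Y.Node → Y.Seq
  | .obs τ => τ
  | .dec q => Y.parent q

/-- The mediator's state only descends in `Y`, so all replies received lie on the path to `lastSeq Y
t`. -/
theorem Reachable.reaches {π : PureStrategy X Y} {g : ∀ q, Y.Action q} {s : X.Node} {t : Y.Node}
    (h : Reachable π s t) (hg : Y.Plays g (lastSeq Y t)) : Reaches π (Y.seqForm g) s t := by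
  induction h with
  | root => exact .root
  | observe j τ _ ih => exact .observe j τ (ih hg)
  | act j τ a _ ha ih => exact .act j τ a (ih hg) ha
  | query j τ q _ hq ih => exact .query j τ q (ih (q.2 ▸ hg)) hq
  | reply j q b _ _ ih => exact .reply j q b (ih (plays_seq.1 hg).2) (seqForm_eq_one.2 hg)

theorem reaches_obs_iff {π : PureStrategy X Y} {g : ∀ q, Y.Action q} {σ : X.Seq} {τ : Y.Seq} :
    Reaches π (Y.seqForm g) (.obs σ) (.obs τ) ↔
      Reachable π (.obs σ) (.obs τ) ∧ Y.Plays g τ :=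
  ⟨fun h => ⟨h.reachable, h.inv.2.2⟩, fun h => h.1.reaches h.2⟩

open Classical in
theorem sum_reachable_mul_seqForm (π : PureStrategy X Y) (g : ∀ q, Y.Action q) (σ : X.Seq) :
    ∑ τ, (if Reachable π (.obs σ) (.obs τ) then 1 else 0) * Y.seqForm g τ =
      X.seqForm (response π g) σ := by
  by_cases hσ : X.Plays (response π g) σ
  · have hr := reaches_obs_iff.1 (reaches_of_plays hσ)
    rw [Fintype.sum_eq_single (mediatorState π g σ), if_pos hr.1, seqForm_eq_one.2 hr.2,
      seqForm_eq_one.2 hσ, one_mul]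
    intro τ hτ
    by_cases h : Reachable π (.obs σ) (.obs τ)
    · rw [seqForm_eq_zero fun hp => hτ (reaches_obs_iff.2 ⟨h, hp⟩).inv.2.1.symm, mul_zero]
    · rw [if_neg h, zero_mul]
  · rw [seqForm_eq_zero hσ]
    refine Finset.sum_eq_zero fun τ _ => ?_
    by_cases h : Reachable π (.obs σ) (.obs τ)
    · rw [seqForm_eq_zero fun hp => hσ (reaches_obs_iff.2 ⟨h, hp⟩).inv.1, mul_zero]
    · rw [if_neg h, zero_mul]

open Classical in
/-- The probability that `(s, t)` is reached under some replies of the mediator. -/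
noncomputable def reachProb (w : PureStrategy X Y → ℝ) (s : X.Node) (t : Y.Node) : ℝ :=
  ∑ π, if Reachable π s t then w π else 0

theorem inducedMap_seqForm (w : stdSimplex ℝ (PureStrategy X Y)) {g : ∀ q, Y.Action q}
    {y : Y.pureStrategies} (hg : Y.seqForm g = y) :
    inducedMap w y = ∑ π, w.1 π • X.seqForm (response π g) := by
  funext σ
  simp only [inducedMap, Finset.sum_apply, Pi.smul_apply, smul_eq_mul]
  refine Finset.sum_congr rfl fun π _ => ?_
  have hp : PlaysTo π y σ ↔ X.Plays (response π g) σ := hg ▸ playsTo_iff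
  by_cases h : X.Plays (response π g) σ
  · rw [if_pos (hp.2 h), seqForm_eq_one.2 h, mul_one]
  · rw [if_neg (mt hp.1 h), seqForm_eq_zero h, mul_zero]

theorem inducedMap_eq_sum_reachProb (w : stdSimplex ℝ (PureStrategy X Y))
    (y : Y.pureStrategies) (σ : X.Seq) :
    inducedMap w y σ = ∑ τ, reachProb w.1 (.obs σ) (.obs τ) * y.1 τ := by
  classical
  obtain ⟨g, hg⟩ := y.2
  rw [inducedMap_seqForm w hg, ← hg]
  simp only [Finset.sum_apply, Pi.smul_apply, smul_eq_mul, ← sum_reachable_mul_seqForm,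
    reachProb, Finset.sum_mul, Finset.mul_sum]
  rw [Finset.sum_comm]
  refine Finset.sum_congr rfl fun τ _ => Finset.sum_congr rfl fun π _ => ?_
  split <;> simp

theorem inducedMap_mem_mixedStrategies (w : stdSimplex ℝ (PureStrategy X Y))
    (y : Y.pureStrategies) : inducedMap w y ∈ X.mixedStrategies := by
  obtain ⟨g, hg⟩ := y.2
  rw [inducedMap_seqForm w hg]
  exact (convex_convexHull ℝ _).sum_mem (fun π _ => w.2.1 π) w.2.2
    fun π _ => subset_convexHull ℝ _ ⟨_, rfl⟩

theorem inducedMap_mem_linearMaps (w : stdSimplex ℝ (PureStrategy X Y)) :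
    inducedMap w ∈ linearMaps Y X := by
  refine ⟨inducedMap_mem_mixedStrategies w,
    Matrix.mulVecLin (Matrix.of fun σ τ => reachProb w.1 (.obs σ) (.obs τ)), fun y => ?_⟩
  funext σ
  rw [inducedMap_eq_sum_reachProb]
  rfl

end Induced

/-! ### Behavioral strategies -/

section Product

variable {ι : Type*} [Fintype ι] [DecidableEq ι] {C : ι → Type*}

theorem prod_update_mul (β : ∀ i, C i → ℝ) (p : ∀ i, C i) (i : ι) (c : C i) :
    (∏ k, β k (Function.update p i c k)) * β i (p i) = (∏ k, β k (p k)) * β i c := by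
  rw [← Finset.mul_prod_erase _ _ (Finset.mem_univ i),
    ← Finset.mul_prod_erase (a := i) _ (fun k => β k (p k)) (Finset.mem_univ i),
    Function.update_self]
  have h : ∏ k ∈ Finset.univ.erase i, β k (Function.update p i c k) =
      ∏ k ∈ Finset.univ.erase i, β k (p k) := Finset.prod_congr rfl fun k hk => by
    rw [Function.update_of_ne (Finset.ne_of_mem_erase hk)]
  rw [h]
  ring

variable [∀ i, Fintype (C i)]

open Classical in
/-- Under a product distribution, a coordinate is independent of every event that does not depend
on that coordinate. -/
theorem sum_prod_and_eq (β : ∀ i, C i → ℝ) (hβ : ∀ i, ∑ c, β i c = 1) (i : ι) (c : C i)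
    (E : (∀ i, C i) → Prop) (hE : ∀ p c, E p → E (Function.update p i c)) :
    (∑ p, if E p ∧ p i = c then ∏ k, β k (p k) else 0) =
      β i c * ∑ p, if E p then ∏ k, β k (p k) else 0 := by
  have hE' : ∀ p c, E (Function.update p i c) ↔ E p := fun p c =>
    ⟨fun h => by simpa using hE _ (p i) h, hE p c⟩
  -- Adjoin an independent copy of coordinate `i` and swap the two. The swap preserves weight and
  -- `E`, and turns the condition on `p i` into one on the copy, which factors out.
  let e : (∀ i, C i) × C i ≃ (∀ i, C i) × C i :=
    Function.Involutive.toPerm (fun x => (Function.update x.1 i x.2, x.1 i)) fun x => by simp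
  have h1 : (∑ p, if E p ∧ p i = c then ∏ k, β k (p k) else 0) =
      ∑ x : (∀ i, C i) × C i,
        if E x.1 ∧ x.1 i = c then (∏ k, β k (x.1 k)) * β i x.2 else 0 := by
    rw [Fintype.sum_prod_type]
    refine Finset.sum_congr rfl fun p _ => ?_
    split
    · simp only [← Finset.mul_sum, hβ, mul_one]
    · simp
  have h2 : (∑ x : (∀ i, C i) × C i,
        if E x.1 ∧ x.2 = c then (∏ k, β k (x.1 k)) * β i x.2 else 0) =
      β i c * ∑ p, if E p then ∏ k, β k (p k) else 0 := by
    rw [Fintype.sum_prod_type, Finset.mul_sum]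
    refine Finset.sum_congr rfl fun p _ => ?_
    by_cases h : E p
    · simp [h, mul_comm]
    · simp [h]
  rw [h1, ← h2]
  refine Fintype.sum_equiv e _ _ fun x => ?_
  change _ = if E (Function.update x.1 i x.2) ∧ x.1 i = c then
    (∏ k, β k (Function.update x.1 i x.2 k)) * β i (x.1 i) else 0
  rw [hE', prod_update_mul]

end Product

instance (j : X.Dec) (τ : Y.Seq) : Nonempty (Choice X Y j τ) :=
  ⟨.inl (Classical.arbitrary _)⟩

open Classical in
/-- Every behavioral strategy of the deviator is realized by a mixed strategy. -/
theorem exists_mixed_of_behavioral (β : ∀ (j : X.Dec) (τ : Y.Seq), Choice X Y j τ → ℝ)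
    (hβ0 : ∀ j τ c, 0 ≤ β j τ c) (hβ1 : ∀ j τ, ∑ c, β j τ c = 1) :
    ∃ w : stdSimplex ℝ (PureStrategy X Y), ∀ (j : X.Dec) (τ : Y.Seq) (c : Choice X Y j τ)
      (E : PureStrategy X Y → Prop),
      (∀ π π' : PureStrategy X Y, (∀ i ρ, ¬ (i = j ∧ ρ = τ) → π i ρ = π' i ρ) → E π → E π') →
      (∑ π, if E π ∧ π j τ = c then w.1 π else 0) = β j τ c * ∑ π, if E π then w.1 π else 0 := by
  let e : (∀ p : X.Dec × Y.Seq, Choice X Y p.1 p.2) ≃ PureStrategy X Y :=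
    { toFun := fun p j τ => p (j, τ)
      invFun := fun π p => π p.1 p.2
      left_inv := fun _ => rfl
      right_inv := fun _ => rfl }
  let β' : ∀ p : X.Dec × Y.Seq, Choice X Y p.1 p.2 → ℝ := fun p => β p.1 p.2
  let W : PureStrategy X Y → ℝ := fun π => ∏ p : X.Dec × Y.Seq, β p.1 p.2 (π p.1 p.2)
  refine ⟨⟨W, fun π => Finset.prod_nonneg fun p _ => hβ0 _ _ _, ?_⟩, fun j τ c E hE => ?_⟩
  · rw [← e.sum_comp]
    change ∑ p : ∀ p : X.Dec × Y.Seq, Choice X Y p.1 p.2, ∏ k, β' k (p k) = 1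
    rw [← Fintype.prod_sum]
    exact Finset.prod_eq_one fun p _ => hβ1 _ _
  · have := sum_prod_and_eq β' (fun p => hβ1 _ _) (j, τ) c (fun p => E (e p)) ?_
    · change (∑ π, if E π ∧ π j τ = c then W π else 0) = β j τ c * ∑ π, if E π then W π else 0
      rw [← e.sum_comp, ← e.sum_comp (fun π => if E π then W π else 0)]
      convert this <;> rfl
    · intro p c' hp
      refine hE _ _ (fun i ρ hi => ?_) hp
      change p (i, ρ) = Function.update p (j, τ) c' (i, ρ)
      rw [Function.update_of_ne]
      rintro h
      exact hi (Prod.ext_iff.1 h)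

/-! ### Flows on the DAG of the deviator -/

/-- The depth of the last decision of the deviator that matters for reaching a node. -/
noncomputable def nodeLevel : X.Node → Y.Node → ℕ
  | .obs σ, .obs τ => X.level σ + Y.level τ
  | .dec j, .obs τ => X.level (X.parent j) + Y.level τ
  | .obs σ, .dec q => X.level σ + (Y.level (Y.parent q) + 1)
  | .dec j, .dec q => X.level (X.parent j) + (Y.level (Y.parent q) + 1)

/-- Levels strictly increase from one decision to the next. In particular, reaching `(j, τ)` is
independent of the choice made there. -/
theorem Reachable.congr {π π' : PureStrategy X Y} {s : X.Node} {t : Y.Node}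
    (h : Reachable π s t) (hπ : ∀ i ρ, X.level (X.parent i) + Y.level ρ < nodeLevel s t →
      π i ρ = π' i ρ) : Reachable π' s t := by
  induction h with
  | root => exact Reaches.root
  | observe j τ _ ih => exact Reaches.observe j τ (ih hπ)
  | act j τ a _ ha ih =>
    have hl : nodeLevel (.obs (X.seq j a)) (.obs τ) = X.level (X.parent j) + Y.level τ + 1 := by
      rw [nodeLevel, X.level_seq]; ring
    rw [hl] at hπ
    refine Reaches.act j τ a (ih fun i ρ hi => hπ i ρ (Nat.lt_succ_of_lt hi)) ?_
    rw [← hπ j τ (Nat.lt_succ_self _), ha]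
  | query j τ q _ hq ih =>
    have hl : nodeLevel (.dec j) (.dec q.1) = X.level (X.parent j) + Y.level τ + 1 := by
      rw [nodeLevel, q.2]; ring
    rw [hl] at hπ
    refine Reaches.query j τ q (ih fun i ρ hi => hπ i ρ (Nat.lt_succ_of_lt hi)) ?_
    rw [← hπ j τ (Nat.lt_succ_self _), hq]
  | reply j q b _ _ ih =>
    refine Reaches.reply j q b (ih fun i ρ hi => hπ i ρ ?_) rfl
    rw [nodeLevel, Y.level_seq]
    exact hi

theorem reachable_root_iff {π : PureStrategy X Y} {τ : Y.Seq} :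
    Reachable π (.obs X.root) (.obs τ) ↔ τ = Y.root := by
  constructor
  · intro h
    unfold Reachable at h
    cases h
    rfl
  · rintro rfl
    exact Reaches.root

theorem Reachable.act_inv {π : PureStrategy X Y} {j : X.Dec} {a : X.Action j} {τ : Y.Seq}
    (h : Reachable π (.obs (X.seq j a)) (.obs τ)) :
    Reachable π (.dec j) (.obs τ) ∧ π j τ = .inl a := by
  unfold Reachable at h
  cases h with
  | act _ _ _ h1 h2 => exact ⟨h1, h2⟩

theorem Reachable.query_inv {π : PureStrategy X Y} {j : X.Dec} {q : Y.Dec}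
    (h : Reachable π (.dec j) (.dec q)) :
    Reachable π (.dec j) (.obs (Y.parent q)) ∧ π j (Y.parent q) = .inr ⟨q, rfl⟩ := by
  unfold Reachable at h
  cases h with
  | query _ τ q' h1 h2 =>
    obtain ⟨q, rfl⟩ := q'
    exact ⟨h1, h2⟩

theorem Reachable.dec_obs_inv {π : PureStrategy X Y} {j : X.Dec} {τ : Y.Seq}
    (h : Reachable π (.dec j) (.obs τ)) :
    Reachable π (.obs (X.parent j)) (.obs τ) ∨
      ∃ q b, τ = Y.seq q b ∧ Reachable π (.dec j) (.dec q) := by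
  unfold Reachable at h
  cases h with
  | observe _ _ h1 => exact .inl h1
  | reply _ q b h1 => exact .inr ⟨q, b, rfl, h1⟩

/-- A nonnegative flow on the decision problem of the deviator: `A σ τ` is the mass at the
observation point `(σ, τ)` and `z j q` the mass at the observation point `(j, q)`. -/
structure IsFlow (A : X.Seq → Y.Seq → ℝ) (z : X.Dec → Y.Dec → ℝ) : Prop where
  nonneg : ∀ σ τ, 0 ≤ A σ τ
  query_nonneg : ∀ j q, 0 ≤ z j q
  root : 1 ≤ A X.root Y.root
  -- The mass at `(j, q)` is copied in full to every reply `qb`, not split among them: the replies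
  -- are not random.
  conserve : ∀ j τ, A (X.parent j) τ + τ.elim 0 (fun s => z j s.1) =
    ∑ a, A (X.seq j a) τ + ∑ q : {q : Y.Dec // Y.parent q = τ}, z j q

/-- A flow determines a mixed strategy that visits no node more often than the flow does. -/
theorem IsFlow.exists_reachProb_le {A : X.Seq → Y.Seq → ℝ} {z : X.Dec → Y.Dec → ℝ}
    (h : IsFlow A z) : ∃ w : stdSimplex ℝ (PureStrategy X Y),
      ∀ σ τ, reachProb w.1 (.obs σ) (.obs τ) ≤ A σ τ := by
  classical
  let F : ∀ (j : X.Dec) (τ : Y.Seq), Choice X Y j τ → ℝ := fun j τ =>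
    Sum.elim (fun a => A (X.seq j a) τ) (fun q => z j q)
  have hF0 : ∀ j τ c, 0 ≤ F j τ c := by
    rintro j τ (a | q)
    · exact h.nonneg _ _
    · exact h.query_nonneg _ _
  have hF : ∀ j τ, ∑ c, F j τ c = A (X.parent j) τ + τ.elim 0 (fun s => z j s.1) := fun j τ => by
    rw [h.conserve, Fintype.sum_sum_type]
    rfl
  -- Normalise the outflow; where there is none, any choice will do.
  have hβ : ∀ (j : X.Dec) (τ : Y.Seq), ∃ β : Choice X Y j τ → ℝ,
      (∀ c, 0 ≤ β c) ∧ ∑ c, β c = 1 ∧ ∀ c, β c * ∑ c, F j τ c = F j τ c := by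
    intro j τ
    rcases eq_or_ne (∑ c, F j τ c) 0 with h0 | h0
    · refine ⟨Pi.single (Classical.arbitrary _) 1, fun c => ?_, by simp, fun c => ?_⟩
      · rw [Pi.single_apply]; split <;> norm_num
      · rw [h0, mul_zero]
        exact ((Finset.sum_eq_zero_iff_of_nonneg fun c _ => hF0 j τ c).1 h0 c
          (Finset.mem_univ c)).symm
    · refine ⟨fun c => F j τ c / ∑ c, F j τ c,
        fun c => div_nonneg (hF0 j τ c) (Finset.sum_nonneg fun c _ => hF0 j τ c), ?_,
        fun c => div_mul_cancel₀ _ h0⟩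
      rw [← Finset.sum_div, div_self h0]
  choose β hβ0 hβ1 hβF using hβ
  obtain ⟨w, hw⟩ := exists_mixed_of_behavioral β hβ0 hβ1
  have hw0 : ∀ π, 0 ≤ w.1 π := w.2.1
  refine ⟨w, ?_⟩
  have hchoice : ∀ (j : X.Dec) (τ : Y.Seq) (c : Choice X Y j τ) (s : X.Node) (t : Y.Node),
      (∀ π, Reachable π s t → Reachable π (.dec j) (.obs τ) ∧ π j τ = c) →
      reachProb w.1 (.dec j) (.obs τ) ≤ ∑ c, F j τ c → reachProb w.1 s t ≤ F j τ c := by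
    intro j τ c s t hst hle
    have hmul := hw j τ c (fun π => Reachable π (.dec j) (.obs τ)) fun π π' hπ hr =>
      hr.congr fun i ρ hi => hπ i ρ (by rintro ⟨rfl, rfl⟩; exact lt_irrefl _ hi)
    calc reachProb w.1 s t
        ≤ ∑ π, if Reachable π (.dec j) (.obs τ) ∧ π j τ = c then w.1 π else 0 := by
          refine Finset.sum_le_sum fun π _ => ?_
          split
          · next hr => rw [if_pos (hst π hr)]
          · split
            · exact hw0 π
            · exact le_rfl
      _ = β j τ c * reachProb w.1 (.dec j) (.obs τ) := hmul
      _ ≤ β j τ c * ∑ c, F j τ c := mul_le_mul_of_nonneg_left hle (hβ0 j τ c)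
      _ = F j τ c := hβF j τ c
  -- A union bound over the two ways to arrive at `(j, τ)`; their disjointness is not needed because
  -- only an upper bound is sought.
  have hunion : ∀ (j : X.Dec) (τ : Y.Seq), reachProb w.1 (.dec j) (.obs τ) ≤
      reachProb w.1 (.obs (X.parent j)) (.obs τ) +
        τ.elim 0 (fun s => reachProb w.1 (.dec j) (.dec s.1)) := by
    intro j τ
    rcases τ with _ | ⟨q, b⟩
    · simp only [Option.elim, add_zero]
      refine Finset.sum_le_sum fun π _ => ?_
      split
      · next hr =>
        rcases hr.dec_obs_inv with h1 | ⟨_, _, h1, _⟩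
        · rw [if_pos h1]
        · simp at h1
      · split
        · exact hw0 π
        · exact le_rfl
    · simp only [Option.elim, reachProb, ← Finset.sum_add_distrib]
      refine Finset.sum_le_sum fun π _ => ?_
      have := hw0 π
      split
      · next hr =>
        rcases hr.dec_obs_inv with h1 | ⟨q', b', h1, h2⟩
        · rw [if_pos h1]
          split <;> linarith
        · cases h1
          rw [if_pos h2]
          split <;> linarith
      · split <;> split <;> linarith
  intro σ
  induction σ using X.seq_induction with
  | root =>
    intro τ
    simp only [reachProb, reachable_root_iff]
    split
    · next hτ => rw [hτ]; exact w.2.2.trans_le h.root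
    · rw [Finset.sum_const_zero]; exact h.nonneg _ _
  | step j a ih =>
    -- For fixed `j`, queries move down `Y`, so the inner induction is on `τ`.
    have hdec : ∀ τ, reachProb w.1 (.dec j) (.obs τ) ≤ ∑ c, F j τ c := by
      intro τ
      induction τ using Y.seq_induction with
      | root =>
        rw [hF]
        exact (hunion j _).trans (add_le_add (ih _) le_rfl)
      | step q b ihq =>
        rw [hF]
        exact (hunion j _).trans (add_le_add (ih _)
          (hchoice j (Y.parent q) (.inr ⟨q, rfl⟩) _ _ (fun π hr => hr.query_inv) ihq))
    exact fun τ => hchoice j τ (.inl a) _ _ (fun π hr => hr.act_inv) (hdec τ)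

/-! ### Linear maps into `co 𝒳` are induced -/

theorem exists_inducedMap_eq {φ : Y.pureStrategies → X.Seq → ℝ}
    (hφ : φ ∈ linearMaps Y X) :
    ∃ w : stdSimplex ℝ (PureStrategy X Y), inducedMap w = φ := by
  classical
  obtain ⟨hmem, L, hL⟩ := hφ
  let c : X.Seq → Y.Seq → ℝ := fun σ τ => LinearMap.toMatrix' L σ τ
  have hc : ∀ (σ : X.Seq) (y : Y.pureStrategies), ∑ τ, c σ τ * y.1 τ = φ y σ := fun σ y => by
    rw [hL, ← LinearMap.toMatrix'_mulVec]
    rfl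
  have hcg : ∀ (σ : X.Seq) (g : ∀ q, Y.Action q),
      ∑ τ, c σ τ * Y.seqForm g τ = φ ⟨Y.seqForm g, g, rfl⟩ σ := fun σ g => hc σ ⟨_, g, rfl⟩
  -- The two coefficient vectors may differ, but they agree as functions on `𝒴`.
  have hcanon : ∀ j, Y.canon (c (X.parent j)) = Y.canon (∑ a, c (X.seq j a)) := fun j => by
    refine Y.canon_congr fun g => ?_
    rw [hcg, ← (mixedStrategies_constraints (hmem _)).2.2 j]
    simp only [Finset.sum_apply, Finset.sum_mul]
    rw [Finset.sum_comm]
    exact Finset.sum_congr rfl fun a _ => (hcg _ g).symm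
  have hflow : IsFlow (fun σ τ => Y.canon (c σ) τ) (fun j q =>
      Y.decValue (∑ a, c (X.seq j a)) q - ∑ a, Y.decValue (c (X.seq j a)) q) :=
    { nonneg := fun σ τ => Y.canon_nonneg (fun g => by
        rw [hcg]; exact (mixedStrategies_constraints (hmem _)).1 σ) τ
      query_nonneg := fun j q => sub_nonneg.2 (Y.sum_decValue_le _ _ _)
      root := by
        -- The root coefficient is the minimum over `𝒴` of the constant function `1`.
        obtain ⟨g, hg⟩ := Y.exists_lowerValue_root (c X.root)
        rw [hcg, (mixedStrategies_constraints (hmem _)).2.1] at hg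
        exact hg.le
      conserve := fun j τ => by
        rw [hcanon]
        exact Y.canon_sum_add (fun a => c (X.seq j a)) τ }
  obtain ⟨w, hw⟩ := hflow.exists_reachProb_le
  refine ⟨w, funext fun y => eq_of_mixedStrategies_le (inducedMap_mem_mixedStrategies w y)
    (hmem y) fun σ => ?_⟩
  rw [inducedMap_eq_sum_reachProb]
  obtain ⟨g, hg⟩ := y.2
  rw [← hc, ← hg, ← Y.sum_canon_mul_seqForm (c σ)]
  exact Finset.sum_le_sum fun τ _ => mul_le_mul_of_nonneg_right (hw σ τ) (seqForm_nonneg g τ)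

end UTC

theorem mainTheorem4 (X : TreeFormDecisionProblem.{u}) (Y : TreeFormDecisionProblem.{v}) :
    TreeFormDecisionProblem.linearMaps Y X =
      Set.range (UTC.inducedMap : stdSimplex ℝ (UTC.PureStrategy X Y) →
        Y.pureStrategies → X.Seq → ℝ) := by
  ext φ
  refine ⟨UTC.exists_inducedMap_eq, ?_⟩
  rintro ⟨w, rfl⟩
  exact UTC.inducedMap_mem_linearMaps w
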